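/- Let $V$ be a set of variables ranging over $\mathbb{Z}$. A linear term is an expression $t = a_1x_1+\dots+a_dx_d+c$ with $x_i \in V$ and $a_i, c \in \mathbb{Z}$; a linear inequality is a formula $t<0$, and a modulo constraint is a formula $t \equiv 0 \bmod q$ with an integer $q \ge 1$. A modulo constraint is simple if it has the form $v \equiv r \bmod q$ with $v \in V$ and $r \in \{0,\dots,q-1\}$. A formula is quantifier-free if it is a Boolean combination (by $\land$, $\lnot$) of linear inequalities and modulo constraints. For distinct variables $x,y$ and a formula $\varphi$, an assignment $\nu : V \to \mathbb{Z}$ satisfies $\exists^{\ge x} y\,\varphi$ if and only if the set $\{n \in \mathbb{Z} : \nu[y \mapsto n] \models \varphi\}$ is infinite or has at least $\nu(x)$ elements. Two formulas are equivalent if they are satisfied by the same assignments. Theorem. For every quantifier-free formula $\varphi$ and all distinct variables $x, y$ (where $x$ may occur in $\varphi$), the formula $\exists^{\ge x} y\,\varphi$ is equivalent to a Boolean combination of linear inequalities and simple modulo constraints. -/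

import Mathlib

namespace PAC

/-- Linear terms `a₁ x₁ + ⋯ + a_d x_d + c` over the variables `V`: finitely many non-zero integer
coefficients and an integer constant. -/
structure LinTerm (V : Type*) where
  /-- the coefficient of each variable -/
  coeff : V →₀ ℤ
  /-- the constant of the term -/
  const : ℤ

/-- The value of a linear term under an assignment. -/
def LinTerm.eval {V : Type*} (ν : V → ℤ) (t : LinTerm V) : ℤ :=
  (t.coeff.sum fun v a => a * ν v) + t.const

/-- Formulae of Presburger arithmetic with unary counting quantifiers. -/
inductive Formula (V : Type*) where
  /-- the linear inequality `t < 0` -/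
  | lt (t : LinTerm V) : Formula V
  /-- the modulo constraint `t ≡ 0 mod q`, with `q ≥ 1` -/
  | mod (t : LinTerm V) (q : ℕ+) : Formula V
  /-- conjunction -/
  | and (φ ψ : Formula V) : Formula V
  /-- negation -/
  | not (φ : Formula V) : Formula V
  /-- the first-order quantifier `∃ y, φ` -/
  | ex (y : V) (φ : Formula V) : Formula V
  /-- the counting quantifier `∃^{≥ x} y, φ`, where `x` and `y` are different variables -/
  | countGE (x y : V) (hxy : x ≠ y) (φ : Formula V) : Formula V

namespace Formula

/-- The satisfaction relation. For the counting quantifier, the set of witnesses has at least `ν x`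
elements; an infinite set has at least `n` elements for every integer `n`. -/
def Sat {V : Type*} [DecidableEq V] : (V → ℤ) → Formula V → Prop
  | ν, lt t => t.eval ν < 0
  | ν, mod t q => ((q : ℕ) : ℤ) ∣ t.eval ν
  | ν, and φ ψ => Sat ν φ ∧ Sat ν ψ
  | ν, not φ => ¬ Sat ν φ
  | ν, ex y φ => ∃ n : ℤ, Sat (Function.update ν y n) φ
  | ν, countGE x y _ φ =>
      {n : ℤ | Sat (Function.update ν y n) φ}.Infinite ∨
        ν x ≤ ({n : ℤ | Sat (Function.update ν y n) φ}.ncard : ℤ)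

/-- Two formulae are equivalent if they are satisfied by the same assignments. -/
def Equivalent {V : Type*} [DecidableEq V] (φ ψ : Formula V) : Prop :=
  ∀ ν : V → ℤ, Sat ν φ ↔ Sat ν ψ

/-- Quantifier-free formulae. -/
def QuantifierFree {V : Type*} : Formula V → Prop
  | lt _ => True
  | mod _ _ => True
  | and φ ψ => QuantifierFree φ ∧ QuantifierFree ψ
  | not φ => QuantifierFree φ
  | ex _ _ => False
  | countGE _ _ _ _ => False

/-- The modulo constraint `v ≡ r mod q`, that is, `v - r ≡ 0 mod q`. It is simple if `r < q`. -/
noncomputable def varMod {V : Type*} (v : V) (r : ℕ) (q : ℕ+) : Formula V :=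
  mod ⟨Finsupp.single v 1, -(r : ℤ)⟩ q

/-- Boolean combinations of linear inequalities and simple modulo constraints. -/
inductive IsSimpleCombination {V : Type*} : Formula V → Prop
  | lt (t : LinTerm V) : IsSimpleCombination (Formula.lt t)
  | varMod (v : V) (r : ℕ) (q : ℕ+) (hr : r < (q : ℕ)) : IsSimpleCombination (Formula.varMod v r q)
  | and {φ ψ : Formula V} (hφ : IsSimpleCombination φ) (hψ : IsSimpleCombination ψ) :
      IsSimpleCombination (Formula.and φ ψ)
  | not {φ : Formula V} (hφ : IsSimpleCombination φ) : IsSimpleCombination (Formula.not φ)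

end Formula

end PAC

/-!
# Quantifier elimination for the unary counting quantifier

The number of solutions `y` of a quantifier-free formula `φ` is, where it is finite, a piecewise
linear function of the assignment, with pieces cut out by linear inequalities and simple modulo
constraints; hence comparing it with the value of `x` is again such a condition.

A function `g` of the assignment is called piecewise linear here if finitely many definable regions
cover all assignments, and on each of them a positive multiple of `g` agrees with a linear term.
Residue information is what makes this class closed under floor division
(`PiecewiseLinear.ediv`); it is also closed under sums and definable case distinctions, and the
conditions `g < 0` and `q ∣ g` are definable. So substituting a piecewise linear function for `y`
in `φ` yields a definable condition (`Definable.sat_update`).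

For a fixed assignment, the truth of `φ` depends on `y` only through its residue modulo some fixed
`M` and its position relative to finitely many piecewise linear thresholds
(`exists_period_thresholds`). The number of solutions in an interval with piecewise linear ends is
therefore piecewise linear (`PiecewiseLinear.card_filter_Ico`): cut the interval at the thresholds
one after another; on an interval without thresholds, each residue class contributes all or nothing.
Finally take `b` above all thresholds in absolute value. The solution set is infinite iff one of the
points `b, …, b + M - 1` or `-b - 1, …, -b - M` is a solution, and otherwise all solutions lie in
`[-b, b)`.
-/

namespace PAC

open Formula

variable {V : Type*}

/-! ### Linear terms as functions -/

/-- A function of the assignment that is the value of a linear term. -/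
def IsAffine (f : (V → ℤ) → ℤ) : Prop :=
  ∃ t : LinTerm V, ∀ ν, t.eval ν = f ν

theorem IsAffine.const (c : ℤ) : IsAffine fun _ : V → ℤ => c :=
  ⟨⟨0, c⟩, fun ν => by simp [LinTerm.eval]⟩

theorem IsAffine.var (v : V) : IsAffine fun ν : V → ℤ => ν v :=
  ⟨⟨Finsupp.single v 1, 0⟩, fun ν => by simp [LinTerm.eval]⟩

theorem IsAffine.add {f g : (V → ℤ) → ℤ} (hf : IsAffine f) (hg : IsAffine g) :
    IsAffine fun ν => f ν + g ν := by
  obtain ⟨s, hs⟩ := hf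
  obtain ⟨t, ht⟩ := hg
  refine ⟨⟨s.coeff + t.coeff, s.const + t.const⟩, fun ν => ?_⟩
  simp only [← hs, ← ht, LinTerm.eval]
  rw [Finsupp.sum_add_index' (by simp) (by intros; ring)]
  ring

theorem IsAffine.const_mul (c : ℤ) {f : (V → ℤ) → ℤ} (hf : IsAffine f) :
    IsAffine fun ν => c * f ν := by
  obtain ⟨s, hs⟩ := hf
  refine ⟨⟨c • s.coeff, c * s.const⟩, fun ν => ?_⟩
  simp only [← hs, LinTerm.eval]
  rw [Finsupp.sum_smul_index (by simp), mul_add, Finsupp.mul_sum]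
  simp only [mul_assoc]

variable [DecidableEq V]

/-- Isolating the variable `y` in a linear term. -/
theorem LinTerm.exists_eval_update (t : LinTerm V) (y : V) :
    ∃ a : ℤ, ∃ f : (V → ℤ) → ℤ, IsAffine f ∧
      ∀ ν n, t.eval (Function.update ν y n) = a * n + f ν := by
  refine ⟨t.coeff y, _, ⟨⟨t.coeff.erase y, t.const⟩, fun ν => rfl⟩, fun ν n => ?_⟩
  simp only [LinTerm.eval]
  rw [← Finsupp.add_sum_erase' t.coeff y _ (by simp)]
  rw [Function.update_self, add_assoc]
  congr 2
  refine Finsupp.sum_congr fun v hv => ?_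
  rw [Function.update_of_ne]
  rintro rfl
  simp at hv

/-! ### Definable conditions -/

/-- A condition on assignments is definable if a Boolean combination of linear inequalities and
simple modulo constraints expresses it. -/
def Definable (P : (V → ℤ) → Prop) : Prop :=
  ∃ ψ : Formula V, ψ.IsSimpleCombination ∧ ∀ ν, Sat ν ψ ↔ P ν

theorem Definable.congr {P Q : (V → ℤ) → Prop} (h : Definable P) (hPQ : ∀ ν, P ν ↔ Q ν) :
    Definable Q :=
  let ⟨ψ, hψ, hs⟩ := h
  ⟨ψ, hψ, fun ν => (hs ν).trans (hPQ ν)⟩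

theorem Definable.and {P Q : (V → ℤ) → Prop} (hP : Definable P) (hQ : Definable Q) :
    Definable fun ν => P ν ∧ Q ν := by
  obtain ⟨ψ, hψ, hs⟩ := hP
  obtain ⟨χ, hχ, ht⟩ := hQ
  exact ⟨.and ψ χ, .and hψ hχ, fun ν => by simp only [Sat, hs, ht]⟩

theorem Definable.not {P : (V → ℤ) → Prop} (hP : Definable P) : Definable fun ν => ¬ P ν := by
  obtain ⟨ψ, hψ, hs⟩ := hP
  exact ⟨.not ψ, .not hψ, fun ν => by simp only [Sat, hs]⟩

theorem Definable.or {P Q : (V → ℤ) → Prop} (hP : Definable P) (hQ : Definable Q) :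
    Definable fun ν => P ν ∨ Q ν :=
  (hP.not.and hQ.not).not.congr fun ν => by tauto

theorem Definable.const (p : Prop) : Definable fun _ : V → ℤ => p := by
  by_cases hp : p
  · exact ⟨.lt ⟨0, -1⟩, .lt _, fun ν => by simp [Sat, LinTerm.eval, hp]⟩
  · exact ⟨.lt ⟨0, 0⟩, .lt _, fun ν => by simp [Sat, LinTerm.eval, hp]⟩

theorem Definable.exists_mem {ι : Type*} (s : Finset ι) {P : ι → (V → ℤ) → Prop}
    (h : ∀ i, Definable (P i)) : Definable fun ν => ∃ i ∈ s, P i ν := by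
  classical
  induction s using Finset.induction_on with
  | empty => exact (Definable.const False).congr fun ν => by simp
  | insert a s _ ih => exact ((h a).or ih).congr fun ν => by simp

theorem Definable.exists {ι : Type*} [Finite ι] {P : ι → (V → ℤ) → Prop}
    (h : ∀ i, Definable (P i)) : Definable fun ν => ∃ i, P i ν := by
  cases nonempty_fintype ι
  exact (Definable.exists_mem Finset.univ h).congr fun ν => by simp

theorem IsAffine.definable_lt_zero {f : (V → ℤ) → ℤ} (hf : IsAffine f) :
    Definable fun ν => f ν < 0 :=
  let ⟨t, ht⟩ := hf
  ⟨.lt t, .lt t, fun ν => by simp only [Sat, ht]⟩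

theorem definable_dvd_var_sub (v : V) (r : ℕ) (q : ℕ) (hr : r < q) :
    Definable fun ν : V → ℤ => (q : ℤ) ∣ ν v - r :=
  ⟨.varMod v r ⟨q, by omega⟩, .varMod v r _ hr,
    fun ν => by simp [Sat, Formula.varMod, LinTerm.eval, sub_eq_add_neg]⟩

/-- A modulo constraint is a Boolean combination of simple ones: distinguish the residues of the
variables one after another. -/
theorem IsAffine.definable_dvd {f : (V → ℤ) → ℤ} (hf : IsAffine f) {q : ℤ} (hq : 0 < q) :
    Definable fun ν => q ∣ f ν := by
  obtain ⟨⟨l, c⟩, ht⟩ := hf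
  lift q to ℕ using hq.le
  suffices h : Definable fun ν : V → ℤ => (q : ℤ) ∣ (l.sum fun v a => a * ν v) + c from
    h.congr fun ν => by rw [← ht]; rfl
  clear ht
  induction l using Finsupp.induction generalizing c with
  | zero => exact (Definable.const ((q : ℤ) ∣ c)).congr fun ν => by simp
  | single_add v a l hv _ ih =>
    refine (Definable.exists fun r : Fin q =>
      (definable_dvd_var_sub v r q r.2).and (ih (c + a * r))).congr fun ν => ?_
    rw [Finsupp.sum_add_index' (by simp) (by intros; ring), Finsupp.sum_single_index (by simp)]
    have key : ∀ r : ℤ, (q : ℤ) ∣ ν v - r →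
        ((q : ℤ) ∣ (l.sum fun v a => a * ν v) + (c + a * r) ↔
          (q : ℤ) ∣ a * ν v + (l.sum fun v a => a * ν v) + c) := by
      intro r hr
      rw [← dvd_add_right (hr.mul_left a)]
      ring_nf
    constructor
    · rintro ⟨r, hr, h⟩
      exact (key r hr).1 h
    · intro h
      have h0 := Int.emod_nonneg (ν v) hq.ne'
      have h1 := Int.emod_lt_of_pos (ν v) hq
      have h2 : (q : ℤ) ∣ ν v - ((ν v % q).toNat : ℤ) := by
        rw [Int.toNat_of_nonneg h0]
        exact Int.dvd_self_sub_emod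
      exact ⟨⟨(ν v % q).toNat, by omega⟩, h2, (key _ h2).2 h⟩

/-! ### Piecewise linear functions -/

/-- A function of the assignment is piecewise linear if finitely many definable regions, not
necessarily disjoint, cover all assignments, and on each region a positive integer multiple of the
function agrees with a linear term. The multiple stands for rational coefficients. -/
def PiecewiseLinear (g : (V → ℤ) → ℤ) : Prop :=
  ∃ (ι : Type) (_ : Finite ι) (P : ι → (V → ℤ) → Prop), (∀ i, Definable (P i)) ∧
    (∀ ν, ∃ i, P i ν) ∧
    ∀ i, ∃ k : ℤ, 0 < k ∧ ∃ f : (V → ℤ) → ℤ, IsAffine f ∧ ∀ ν, P i ν → k * g ν = f ν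

theorem IsAffine.piecewiseLinear {f : (V → ℤ) → ℤ} (hf : IsAffine f) : PiecewiseLinear f :=
  ⟨Unit, inferInstance, fun _ _ => True, fun _ => .const True, fun _ => ⟨(), trivial⟩,
    fun _ => ⟨1, one_pos, f, hf, fun _ _ => one_mul _⟩⟩

namespace PiecewiseLinear

/-- Piecewise linearity is local: it may be checked on a finite definable cover. -/
theorem glue {ι : Type} [Finite ι] {P : ι → (V → ℤ) → Prop} (hP : ∀ i, Definable (P i))
    (hcov : ∀ ν, ∃ i, P i ν) {h : ι → (V → ℤ) → ℤ} (hh : ∀ i, PiecewiseLinear (h i))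
    {g : (V → ℤ) → ℤ} (hg : ∀ i ν, P i ν → g ν = h i ν) : PiecewiseLinear g := by
  choose κ hκ Q hQ hQc hl using hh
  refine ⟨Σ i, κ i, inferInstance, fun j ν => P j.1 ν ∧ Q j.1 j.2 ν,
    fun j => (hP _).and (hQ _ _), fun ν => ?_, fun ⟨i, j⟩ => ?_⟩
  · obtain ⟨i, hi⟩ := hcov ν
    obtain ⟨j, hj⟩ := hQc i ν
    exact ⟨⟨i, j⟩, hi, hj⟩
  · obtain ⟨k, hk, f, hf, he⟩ := hl i j
    exact ⟨k, hk, f, hf, fun ν hν => by rw [hg i ν hν.1, he ν hν.2]⟩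

theorem const (c : ℤ) : PiecewiseLinear fun _ : V → ℤ => c :=
  (IsAffine.const c).piecewiseLinear

theorem add {g h : (V → ℤ) → ℤ} (hg : PiecewiseLinear g) (hh : PiecewiseLinear h) :
    PiecewiseLinear fun ν => g ν + h ν := by
  obtain ⟨ι, _, P, hP, hPc, hl⟩ := hg
  obtain ⟨κ, _, Q, hQ, hQc, hm⟩ := hh
  refine ⟨ι × κ, inferInstance, fun j ν => P j.1 ν ∧ Q j.2 ν, fun j => (hP _).and (hQ _),
    fun ν => ?_, fun ⟨i, j⟩ => ?_⟩
  · obtain ⟨i, hi⟩ := hPc ν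
    obtain ⟨j, hj⟩ := hQc ν
    exact ⟨(i, j), hi, hj⟩
  · obtain ⟨k, hk, f, hf, he⟩ := hl i
    obtain ⟨k', hk', f', hf', he'⟩ := hm j
    refine ⟨k * k', mul_pos hk hk', _, (hf.const_mul k').add (hf'.const_mul k), fun ν hν => ?_⟩
    rw [← he ν hν.1, ← he' ν hν.2]
    ring

theorem const_mul (c : ℤ) {g : (V → ℤ) → ℤ} (hg : PiecewiseLinear g) :
    PiecewiseLinear fun ν => c * g ν := by
  obtain ⟨ι, _, P, hP, hPc, hl⟩ := hg
  refine ⟨ι, inferInstance, P, hP, hPc, fun i => ?_⟩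
  obtain ⟨k, hk, f, hf, he⟩ := hl i
  exact ⟨k, hk, _, hf.const_mul c, fun ν hν => by rw [← he ν hν]; ring⟩

theorem neg {g : (V → ℤ) → ℤ} (hg : PiecewiseLinear g) : PiecewiseLinear fun ν => -g ν := by
  simpa using hg.const_mul (-1)

theorem sub {g h : (V → ℤ) → ℤ} (hg : PiecewiseLinear g) (hh : PiecewiseLinear h) :
    PiecewiseLinear fun ν => g ν - h ν := by
  simpa [sub_eq_add_neg] using hg.add hh.neg

theorem sum {ι : Type*} (s : Finset ι) {g : ι → (V → ℤ) → ℤ} (hg : ∀ i, PiecewiseLinear (g i)) :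
    PiecewiseLinear fun ν => ∑ i ∈ s, g i ν := by
  classical
  induction s using Finset.induction_on with
  | empty => simpa using const 0
  | insert a s ha ih => simpa [Finset.sum_insert ha] using (hg a).add ih

theorem definable_lt_zero {g : (V → ℤ) → ℤ} (hg : PiecewiseLinear g) :
    Definable fun ν => g ν < 0 := by
  obtain ⟨ι, _, P, hP, hPc, hl⟩ := hg
  choose k hk f hf he using hl
  refine (Definable.exists fun i => (hP i).and (hf i).definable_lt_zero).congr fun ν => ?_
  have key : ∀ i, P i ν → (f i ν < 0 ↔ g ν < 0) := fun i hi => by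
    rw [← he i ν hi]
    exact ⟨fun h => neg_of_mul_neg_right h (hk i).le, mul_neg_of_pos_of_neg (hk i)⟩
  constructor
  · rintro ⟨i, hi, h⟩
    exact (key i hi).1 h
  · intro h
    obtain ⟨i, hi⟩ := hPc ν
    exact ⟨i, hi, (key i hi).2 h⟩

theorem definable_lt {g h : (V → ℤ) → ℤ} (hg : PiecewiseLinear g) (hh : PiecewiseLinear h) :
    Definable fun ν => g ν < h ν :=
  (hg.sub hh).definable_lt_zero.congr fun _ => sub_neg

theorem definable_dvd {g : (V → ℤ) → ℤ} (hg : PiecewiseLinear g) {q : ℤ} (hq : 0 < q) :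
    Definable fun ν => q ∣ g ν := by
  obtain ⟨ι, _, P, hP, hPc, hl⟩ := hg
  choose k hk f hf he using hl
  refine (Definable.exists fun i =>
    (hP i).and ((hf i).definable_dvd (mul_pos (hk i) hq))).congr fun ν => ?_
  have key : ∀ i, P i ν → (k i * q ∣ f i ν ↔ q ∣ g ν) := fun i hi => by
    rw [← he i ν hi, mul_dvd_mul_iff_left (hk i).ne']
  constructor
  · rintro ⟨i, hi, h⟩
    exact (key i hi).1 h
  · intro h
    obtain ⟨i, hi⟩ := hPc ν
    exact ⟨i, hi, (key i hi).2 h⟩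

open Classical in
theorem ite {P : (V → ℤ) → Prop} (hP : Definable P) {g h : (V → ℤ) → ℤ}
    (hg : PiecewiseLinear g) (hh : PiecewiseLinear h) :
    PiecewiseLinear fun ν => if P ν then g ν else h ν := by
  refine glue (ι := Bool) (P := fun b ν => cond b (P ν) (¬ P ν)) (h := fun b => cond b g h)
    ?_ ?_ ?_ ?_
  · rintro (_ | _)
    exacts [hP.not, hP]
  · intro ν
    by_cases h : P ν
    exacts [⟨true, h⟩, ⟨false, h⟩]
  · rintro (_ | _)
    exacts [hh, hg]
  · rintro (_ | _) ν h
    exacts [if_neg h, if_pos h]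

theorem min {g h : (V → ℤ) → ℤ} (hg : PiecewiseLinear g) (hh : PiecewiseLinear h) :
    PiecewiseLinear fun ν => min (g ν) (h ν) := by
  convert ite (hh.definable_lt hg) hh hg using 2 with ν
  split_ifs <;> omega

theorem max {g h : (V → ℤ) → ℤ} (hg : PiecewiseLinear g) (hh : PiecewiseLinear h) :
    PiecewiseLinear fun ν => max (g ν) (h ν) := by
  convert ite (hg.definable_lt hh) hh hg using 2 with ν
  split_ifs <;> omega

/-- If `k * g = f` on a region and `g` has residue `s` modulo `d`, then
`(k * d) * (g / d) = f - k * s`. -/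
theorem ediv {g : (V → ℤ) → ℤ} (hg : PiecewiseLinear g) {d : ℤ} (hd : 0 < d) :
    PiecewiseLinear fun ν => g ν / d := by
  lift d to ℕ using hd.le
  have hdvd (s : ℤ) : Definable fun ν => (d : ℤ) ∣ g ν - s := (hg.sub (const s)).definable_dvd hd
  obtain ⟨ι, _, P, hP, hPc, hl⟩ := hg
  refine ⟨ι × Fin d, inferInstance, fun j ν => P j.1 ν ∧ (d : ℤ) ∣ g ν - (j.2 : ℕ),
    fun j => (hP _).and (hdvd _), fun ν => ?_, fun ⟨i, s⟩ => ?_⟩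
  · obtain ⟨i, hi⟩ := hPc ν
    have h0 := Int.emod_nonneg (g ν) hd.ne'
    have h1 := Int.emod_lt_of_pos (g ν) hd
    refine ⟨(i, ⟨(g ν % d).toNat, by omega⟩), hi, ?_⟩
    simp only [Int.toNat_of_nonneg h0]
    exact Int.dvd_self_sub_emod
  · obtain ⟨k, hk, f, hf, he⟩ := hl i
    refine ⟨k * d, mul_pos hk hd, _, hf.add (IsAffine.const (-(k * s))), fun ν hν => ?_⟩
    obtain ⟨m, hm⟩ := hν.2
    have hs : g ν = (s : ℕ) + d * m := by linarith
    have hq : g ν / d = m := by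
      rw [hs, Int.add_mul_ediv_left _ _ hd.ne', Int.ediv_eq_zero_of_lt (by omega) (by omega),
        zero_add]
    simp only [← he ν hν.1, hq]
    rw [hs]
    ring

end PiecewiseLinear

/-! ### Quantifier-free formulae in one distinguished variable -/

theorem Definable.sat_update (y : V) {φ : Formula V} (hφ : φ.QuantifierFree)
    {g : (V → ℤ) → ℤ} (hg : PiecewiseLinear g) :
    Definable fun ν => Sat (Function.update ν y (g ν)) φ := by
  induction φ with
  | lt t =>
    obtain ⟨a, f, hf, he⟩ := t.exists_eval_update y
    exact ((hg.const_mul a).add hf.piecewiseLinear).definable_lt_zero.congr fun ν => by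
      simp only [Sat, he]
  | mod t q =>
    obtain ⟨a, f, hf, he⟩ := t.exists_eval_update y
    exact (((hg.const_mul a).add hf.piecewiseLinear).definable_dvd
      (q := (q : ℕ)) (by exact_mod_cast q.pos)).congr fun ν => by simp only [Sat, he]
  | and φ ψ ih₁ ih₂ => exact (ih₁ hφ.1).and (ih₂ hφ.2)
  | not φ ih => exact (ih hφ).not
  | ex => exact hφ.elim
  | countGE => exact hφ.elim

/-- For a fixed assignment, the truth of a quantifier-free formula depends on the variable `y` only
through its residue modulo `M` and its position relative to finitely many thresholds. -/
theorem exists_period_thresholds (y : V) {φ : Formula V} (hφ : φ.QuantifierFree) :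
    ∃ M : ℕ, 0 < M ∧ ∃ T : List ((V → ℤ) → ℤ), (∀ t ∈ T, PiecewiseLinear t) ∧
      ∀ ν (z z' : ℤ), (M : ℤ) ∣ z - z' → (∀ t ∈ T, (z < t ν ↔ z' < t ν)) →
        (Sat (Function.update ν y z) φ ↔ Sat (Function.update ν y z') φ) := by
  induction φ with
  | lt t =>
    obtain ⟨a, f, hf, he⟩ := t.exists_eval_update y
    have hf' := hf.piecewiseLinear
    simp only [Sat, he]
    rcases lt_trichotomy a 0 with ha | rfl | ha
    · -- Here `a * z + f < 0` says that `z > f / (-a)`, rounded down.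
      have key : ∀ ν z, a * z + f ν < 0 ↔ ¬ z < f ν / (-a) + 1 := fun ν z => by
        rw [not_lt, Int.add_one_le_iff, Int.ediv_lt_iff_lt_mul (by omega)]
        constructor <;> intro h <;> linarith
      refine ⟨1, one_pos, [fun ν => f ν / (-a) + 1], ?_, fun ν z z' _ h => ?_⟩
      · simpa using (hf'.ediv (d := -a) (by omega)).add (.const 1)
      · rw [key, key, h _ (List.mem_singleton_self _)]
    · exact ⟨1, one_pos, [], by simp, by simp⟩
    · have key : ∀ ν z, a * z + f ν < 0 ↔ z < (-f ν - 1) / a + 1 := fun ν z => by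
        rw [Int.lt_add_one_iff, Int.le_ediv_iff_mul_le ha]
        constructor <;> intro h <;> linarith
      refine ⟨1, one_pos, [fun ν => (-f ν - 1) / a + 1], ?_, fun ν z z' _ h => ?_⟩
      · simpa using ((hf'.neg.sub (.const 1)).ediv ha).add (.const 1)
      · rw [key, key, h _ (List.mem_singleton_self _)]
  | mod t q =>
    obtain ⟨a, f, hf, he⟩ := t.exists_eval_update y
    refine ⟨q, q.pos, [], by simp, fun ν z z' hz _ => ?_⟩
    simp only [Sat, he]
    rw [← dvd_add_right (hz.mul_left a) (c := a * z' + f ν)]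
    ring_nf
  | and φ ψ ih₁ ih₂ =>
    obtain ⟨M, hM, T, hT, h⟩ := ih₁ hφ.1
    obtain ⟨M', hM', T', hT', h'⟩ := ih₂ hφ.2
    refine ⟨M * M', mul_pos hM hM', T ++ T', ?_, fun ν z z' hz ht => ?_⟩
    · simpa [or_imp, forall_and] using ⟨hT, hT'⟩
    · push_cast at hz
      have h₁ := h ν z z' (dvd_of_mul_right_dvd hz) fun t m => ht t (by simp [m])
      have h₂ := h' ν z z' (dvd_of_mul_left_dvd hz) fun t m => ht t (by simp [m])
      simp only [Sat, h₁, h₂]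
  | not φ ih =>
    obtain ⟨M, hM, T, hT, h⟩ := ih hφ
    exact ⟨M, hM, T, hT, fun ν z z' hz ht => not_congr (h ν z z' hz ht)⟩
  | ex => exact hφ.elim
  | countGE => exact hφ.elim

/-! ### Counting solutions -/

open Classical in
/-- In an interval on which `p` is periodic with period `M`, each residue class lies either entirely
inside or entirely outside the set of solutions of `p`. -/
theorem card_filter_Ico_of_periodic {M : ℕ} (hM : 0 < M) (a b : ℤ) (p : ℤ → Prop)
    (hp : ∀ z z', z ∈ Finset.Ico a b → z' ∈ Finset.Ico a b → (M : ℤ) ∣ z - z' → (p z ↔ p z')) :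
    (((Finset.Ico a b).filter p).card : ℤ) =
      ∑ r ∈ Finset.range M, if a + r < b ∧ p (a + r) then (b - a - r - 1) / M + 1 else 0 := by
  have hM' : (0 : ℤ) < M := by exact_mod_cast hM
  rw [Finset.card_eq_sum_card_fiberwise (f := fun z => ((z - a) % M).toNat)
    (t := Finset.range M)]
  · push_cast
    refine Finset.sum_congr rfl fun r hr => ?_
    rw [Finset.mem_range] at hr
    have hres : ∀ z, a ≤ z → (((z - a) % M).toNat = r ↔ ∃ k : ℕ, z = a + r + M * k) := by
      intro z hz
      constructor
      · intro h
        have h0 := Int.emod_nonneg (z - a) hM'.ne'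
        have h1 := Int.mul_ediv_add_emod (z - a) M
        refine ⟨((z - a) / M).toNat, ?_⟩
        rw [Int.toNat_of_nonneg (Int.ediv_nonneg (by omega) hM'.le)]
        omega
      · rintro ⟨k, rfl⟩
        have : a + r + M * k - a = (r : ℤ) + M * k := by ring
        rw [this, Int.add_mul_emod_self_left, Int.emod_eq_of_lt (by omega) (by omega)]
        simp
    split_ifs with h
    · have h0 : 0 ≤ (b - a - r - 1) / M := Int.ediv_nonneg (by omega) hM'.le
      have hlt : ∀ k : ℕ, a + r + M * k < b ↔ k < ((b - a - r - 1) / M + 1).toNat := by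
        intro k
        have : (k : ℤ) ≤ (b - a - r - 1) / M ↔ _ := Int.le_ediv_iff_mul_le hM'
        rw [mul_comm] at this
        omega
      have himg : {z ∈ (Finset.Ico a b).filter p | ((z - a) % M).toNat = r} =
          (Finset.range ((b - a - r - 1) / M + 1).toNat).image
            fun k : ℕ => a + r + (M : ℤ) * k := by
        ext z
        simp only [Finset.mem_filter, Finset.mem_Ico, Finset.mem_image, Finset.mem_range]
        constructor
        · rintro ⟨⟨⟨hz, hzb⟩, _⟩, hzr⟩
          obtain ⟨k, rfl⟩ := (hres z hz).1 hzr
          exact ⟨k, (hlt k).1 hzb, rfl⟩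
        · rintro ⟨k, hk, rfl⟩
          have hz : a ≤ a + r + M * k := by
            have hk0 : (0 : ℤ) ≤ M * k := by positivity
            omega
          have hzb := (hlt k).2 hk
          refine ⟨⟨⟨hz, hzb⟩, ?_⟩, (hres _ hz).2 ⟨k, rfl⟩⟩
          refine (hp _ (a + r) (by simp [hz, hzb]) (by simp [h.1]) ?_).2 h.2
          exact ⟨k, by ring⟩
      rw [himg, Finset.card_image_of_injective, Finset.card_range, Int.toNat_of_nonneg (by omega)]
      intro k l hkl
      simpa [hM.ne'] using hkl
    · rw [Nat.cast_eq_zero, Finset.card_eq_zero, Finset.filter_eq_empty_iff]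
      intro z hz hzr
      simp only [Finset.mem_filter, Finset.mem_Ico] at hz
      obtain ⟨k, rfl⟩ := (hres z hz.1.1).1 hzr
      have hk : (0 : ℤ) ≤ M * k := by positivity
      have hb : a + r < b := by omega
      exact h ⟨hb, (hp _ (a + r) (by simp [hz.1]) (by simp [hb]) ⟨k, by ring⟩).1 hz.2⟩
  · intro z _
    have h0 := Int.emod_nonneg (z - a) hM'.ne'
    have h1 := Int.emod_lt_of_pos (z - a) hM'
    simp only [Finset.coe_range, Set.mem_Iio]
    omega

open Classical in
/-- The number of solutions in an interval with piecewise linear ends is piecewise linear. The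
periodicity is required only inside the interval, so that the induction can cut the interval at a
threshold and drop this threshold on both sides. -/
theorem PiecewiseLinear.card_filter_Ico {M : ℕ} (hM : 0 < M) {R : (V → ℤ) → ℤ → Prop}
    (hR : ∀ g, PiecewiseLinear g → Definable fun ν => R ν (g ν))
    (T : List ((V → ℤ) → ℤ)) (hT : ∀ t ∈ T, PiecewiseLinear t) {a b : (V → ℤ) → ℤ}
    (ha : PiecewiseLinear a) (hb : PiecewiseLinear b)
    (h : ∀ ν (z z' : ℤ), z ∈ Finset.Ico (a ν) (b ν) → z' ∈ Finset.Ico (a ν) (b ν) →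
      (M : ℤ) ∣ z - z' → (∀ t ∈ T, (z < t ν ↔ z' < t ν)) → (R ν z ↔ R ν z')) :
    PiecewiseLinear fun ν => (((Finset.Ico (a ν) (b ν)).filter (R ν)).card : ℤ) := by
  induction T generalizing a b with
  | nil =>
    have hM' : (0 : ℤ) < M := by exact_mod_cast hM
    have key : PiecewiseLinear fun ν => ∑ r ∈ Finset.range M,
        if a ν + r < b ν ∧ R ν (a ν + r) then (b ν - a ν - r - 1) / M + 1 else 0 := by
      refine .sum _ fun r => ?_
      have har := ha.add (.const (r : ℤ))
      convert ite ((har.definable_lt hb).and (hR _ har))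
        (((((hb.sub ha).sub (.const (r : ℤ))).sub (.const 1)).ediv hM').add (.const 1)) (.const 0)
    convert key using 2 with ν
    exact card_filter_Ico_of_periodic hM _ _ _ fun z z' hz hz' hd => h ν z z' hz hz' hd (by simp)
  | cons t T ih =>
    have ht := hT t (by simp)
    have hT' : ∀ s ∈ T, PiecewiseLinear s := fun s hs => hT s (by simp [hs])
    have h₁ := ih hT' ha (ht.min hb) fun ν z z' hz hz' hd hs => by
      simp only [Finset.mem_Ico] at hz hz'
      refine h ν z z' (by simp; omega) (by simp; omega) hd ?_
      simp only [List.mem_cons, forall_eq_or_imp]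
      exact ⟨by omega, hs⟩
    have h₂ := ih hT' (ht.max ha) hb fun ν z z' hz hz' hd hs => by
      simp only [Finset.mem_Ico] at hz hz'
      refine h ν z z' (by simp; omega) (by simp; omega) hd ?_
      simp only [List.mem_cons, forall_eq_or_imp]
      exact ⟨by omega, hs⟩
    convert h₁.add h₂ using 2 with ν
    rw [← Nat.cast_add, ← Finset.card_union_of_disjoint]
    · congr 2
      ext z
      simp only [Finset.mem_filter, Finset.mem_Ico, Finset.mem_union]
      by_cases hz : R ν z <;> simp only [hz, and_true, and_false, or_false]
      omega
    · rw [Finset.disjoint_left]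
      intro z hz hz'
      simp only [Finset.mem_filter, Finset.mem_Ico] at hz hz'
      omega

theorem PiecewiseLinear.exists_abs_le (T : List ((V → ℤ) → ℤ)) (hT : ∀ t ∈ T, PiecewiseLinear t) :
    ∃ b : (V → ℤ) → ℤ, PiecewiseLinear b ∧ (∀ ν, 0 ≤ b ν) ∧ ∀ t ∈ T, ∀ ν, |t ν| ≤ b ν := by
  induction T with
  | nil => exact ⟨_, .const 0, by simp, by simp⟩
  | cons t T ih =>
    obtain ⟨b, hb, h0, h⟩ := ih fun s hs => hT s (by simp [hs])
    have ht := hT t (by simp)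
    refine ⟨_, hb.max (ht.max ht.neg), fun ν => le_max_of_le_left (h0 ν), ?_⟩
    simp only [List.mem_cons, forall_eq_or_imp]
    exact ⟨fun ν => le_max_right _ _, fun s hs ν => le_max_of_le_left (h s hs ν)⟩

/-- If a predicate is periodic on `[b, ∞)` and on `(-∞, -b)`, its solution set is infinite as soon
as there is a solution in the first period on either side; otherwise it lies in `[-b, b)`. -/
theorem infinite_or_subset_of_periodic {M : ℕ} (hM : 0 < M) {b : ℤ} {p : ℤ → Prop}
    (hr : ∀ z z', b ≤ z → b ≤ z' → (M : ℤ) ∣ z - z' → (p z ↔ p z'))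
    (hl : ∀ z z', z < -b → z' < -b → (M : ℤ) ∣ z - z' → (p z ↔ p z')) :
    ((∃ r ∈ Finset.range M, p (b + r) ∨ p (-b - 1 - r)) → {z | p z}.Infinite) ∧
      (¬ (∃ r ∈ Finset.range M, p (b + r) ∨ p (-b - 1 - r)) →
        {z | p z} ⊆ Finset.Ico (-b) b) := by
  have hM' : (0 : ℤ) < M := by exact_mod_cast hM
  constructor
  · rintro ⟨r, _, h | h⟩
    · refine Set.infinite_of_injective_forall_mem (f := fun k : ℕ => b + r + (M : ℤ) * k) ?_ ?_
      · intro k l hkl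
        simpa [hM.ne'] using hkl
      · intro k
        have hk : (0 : ℤ) ≤ M * k := by positivity
        exact (hr _ _ (by omega) (by omega) ⟨k, by ring⟩).2 h
    · refine Set.infinite_of_injective_forall_mem
        (f := fun k : ℕ => -b - 1 - r - (M : ℤ) * k) ?_ ?_
      · intro k l hkl
        simpa [hM.ne'] using hkl
      · intro k
        have hk : (0 : ℤ) ≤ M * k := by positivity
        exact (hl _ _ (by omega) (by omega) ⟨-k, by ring⟩).2 h
  · intro h z hz
    by_contra hz'
    rw [Finset.coe_Ico, Set.mem_Ico, not_and_or, not_le, not_lt] at hz'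
    apply h
    rcases hz' with hz' | hz'
    · have h0 := Int.emod_nonneg (-b - 1 - z) hM'.ne'
      have h1 := Int.emod_lt_of_pos (-b - 1 - z) hM'
      refine ⟨((-b - 1 - z) % M).toNat, by simp; omega, Or.inr ?_⟩
      rw [Int.toNat_of_nonneg h0]
      refine (hl z _ hz' (by omega) ?_).1 hz
      rw [dvd_sub_comm, sub_right_comm]
      exact Int.dvd_self_sub_emod
    · have h0 := Int.emod_nonneg (z - b) hM'.ne'
      have h1 := Int.emod_lt_of_pos (z - b) hM'
      refine ⟨((z - b) % M).toNat, by simp; omega, Or.inl ?_⟩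
      rw [Int.toNat_of_nonneg h0]
      refine (hr z _ hz' (by omega) ?_).1 hz
      rw [← sub_sub]
      exact Int.dvd_self_sub_emod

end PAC

theorem theorem1 {V : Type*} [DecidableEq V] (x y : V) (hxy : x ≠ y) (φ : PAC.Formula V)
    (hφ : φ.QuantifierFree) :
    ∃ ψ : PAC.Formula V, ψ.IsSimpleCombination ∧
      PAC.Formula.Equivalent (PAC.Formula.countGE x y hxy φ) ψ := by
  classical
  obtain ⟨M, hM, T, hT, hper⟩ := PAC.exists_period_thresholds y hφ
  obtain ⟨b, hb, hb0, hbT⟩ := PAC.PiecewiseLinear.exists_abs_le T hT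
  let R : (V → ℤ) → ℤ → Prop := fun ν z => PAC.Formula.Sat (Function.update ν y z) φ
  have hR : ∀ g, PAC.PiecewiseLinear g → PAC.Definable fun ν => R ν (g ν) :=
    fun g hg => PAC.Definable.sat_update y hφ hg
  have hcard := PAC.PiecewiseLinear.card_filter_Ico hM hR T hT hb.neg hb
    fun ν z z' _ _ => hper ν z z'
  have hinf : PAC.Definable fun ν =>
      ∃ r ∈ Finset.range M, R ν (b ν + r) ∨ R ν (-b ν - 1 - r) :=
    .exists_mem _ fun r => (hR _ (hb.add (.const r))).or
      (hR _ ((hb.neg.sub (.const 1)).sub (.const r)))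
  obtain ⟨ψ, hψ, hs⟩ :=
    hinf.or (hcard.definable_lt (PAC.IsAffine.var x).piecewiseLinear).not
  refine ⟨ψ, hψ, fun ν => ?_⟩
  rw [hs]
  simp only [PAC.Formula.Sat, not_lt]
  obtain ⟨h₁, h₂⟩ := PAC.infinite_or_subset_of_periodic hM (b := b ν) (p := R ν)
    (fun z z' hz hz' hd => hper ν z z' hd fun t ht => by
      have := abs_le.1 (hbT t ht ν); omega)
    (fun z z' hz hz' hd => hper ν z z' hd fun t ht => by
      have := abs_le.1 (hbT t ht ν); omega)
  by_cases h : ∃ r ∈ Finset.range M, R ν (b ν + r) ∨ R ν (-b ν - 1 - r)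
  · exact iff_of_true (.inl (h₁ h)) (.inl h)
  · have hsub := h₂ h
    have hfin : ¬ {z | R ν z}.Infinite :=
      Set.not_infinite.2 ((Finset.finite_toSet _).subset hsub)
    have hset : {z | R ν z} = ((Finset.Ico (-b ν) (b ν)).filter (R ν) : Set ℤ) := by
      ext z
      rw [Finset.coe_filter]
      exact ⟨fun hz => ⟨by simpa using hsub hz, hz⟩, fun hz => hz.2⟩
    have hcount : {z | R ν z}.ncard = ((Finset.Ico (-b ν) (b ν)).filter (R ν)).card := by
      rw [hset, Set.ncard_coe_finset]
    rw [← hcount]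
    exact or_congr (iff_of_false hfin h) Iff.rfl
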